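/- Let $\kappa$ be a weakly compact cardinal, i.e. an uncountable cardinal such that every colouring $c:[\kappa]^2\to 2$ has a homogeneous set of size $\kappa$; and let $\mathrm{reg}(\kappa)$ denote the set of all infinite regular cardinals below $\kappa$. Then for every set $S$ with $\mathrm{reg}(\kappa)\subseteq S\subseteq\kappa$, the principle $\clubsuit_{\mathrm{AD}}(\{S\},1,1)$ fails. That is, there is no sequence $\langle\mathcal A_\alpha\mid\alpha\in S\rangle$ of families of subsets of $\kappa$ with all of the following properties: (i) for every nonzero limit ordinal $\alpha\in S$, $\mathcal A_\alpha$ is a nonempty family of pairwise disjoint cofinal subsets of $\alpha$; (ii) for any two distinct $A,A'\in\bigcup_{\alpha\in S}\mathcal A_\alpha$, $\sup(A\cap A')<\sup(A)$; (iii) $|\mathcal A_\alpha|=1$ for every $\alpha\in S$; (iv) for every family $\mathcal B$ of subsets of $\kappa$, each of size $\kappa$, with $|\mathcal B|\le 1$, the set $\{\alpha\in S\mid \sup(A\cap B)=\alpha\text{ for all }A\in\mathcal A_\alpha\text{ and }B\in\mathcal B\}$ is stationary in $\kappa$. -/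

import Mathlib

universe u

namespace ClubAD

open Cardinal Set

/-- `κ` is weakly compact: it is uncountable and `κ → (κ)²₂`, that is, every colouring of the
pairs `α < β` below `κ` with two colours has a homogeneous set of size `κ`. -/
def IsWeaklyCompact (κ : Cardinal.{u}) : Prop :=
  ℵ₀ < κ ∧
    ∀ c : Ordinal.{u} → Ordinal.{u} → Bool,
      ∃ H : Set Ordinal.{u}, H ⊆ Iio κ.ord ∧ #H = Cardinal.lift.{u + 1} κ ∧
        ∃ i : Bool, ∀ α ∈ H, ∀ β ∈ H, α < β → c α β = i

/-- The set of all infinite regular cardinals below `κ`, as a set of ordinals. -/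
def reg (κ : Cardinal.{u}) : Set Ordinal.{u} :=
  {α | ∃ μ : Cardinal.{u}, μ.IsRegular ∧ μ < κ ∧ α = μ.ord}

/-- `acc C = {α ∈ C | sup (C ∩ α) = α > 0}`. -/
def acc (C : Set Ordinal.{u}) : Set Ordinal.{u} :=
  {α | α ∈ C ∧ sSup (C ∩ Iio α) = α ∧ 0 < α}

/-- `A` is a cofinal subset of the ordinal `α`. -/
def IsCofinalIn (A : Set Ordinal.{u}) (α : Ordinal.{u}) : Prop :=
  A ⊆ Iio α ∧ ∀ β < α, ∃ γ ∈ A, β ≤ γ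

/-- `G` meets every closed unbounded subset of `κ`. -/
def IsStationaryIn (κ : Cardinal.{u}) (G : Set Ordinal.{u}) : Prop :=
  IsStationary (Subtype.val ⁻¹' G : Set (Iio κ.ord))

/-- `⟨𝒜 α | α ∈ S⟩` is an AD-multi-ladder system. Only the values of `𝒜` on `S` matter; at
`α ∈ S` outside `acc κ`, the members of `𝒜 α` may be any subsets of `κ`. -/
structure IsADMultiLadderSystem (κ : Cardinal.{u}) (S : Set Ordinal.{u})
    (𝒜 : Ordinal.{u} → Set (Set Ordinal.{u})) : Prop where
  subset : ∀ α ∈ S, ∀ A ∈ 𝒜 α, A ⊆ Iio κ.ord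
  nonempty : ∀ α ∈ S ∩ acc (Iio κ.ord), (𝒜 α).Nonempty
  cofinal : ∀ α ∈ S ∩ acc (Iio κ.ord), ∀ A ∈ 𝒜 α, IsCofinalIn A α
  disjoint : ∀ α ∈ S ∩ acc (Iio κ.ord), ∀ A ∈ 𝒜 α, ∀ A' ∈ 𝒜 α, A ≠ A' → Disjoint A A'
  almost_disjoint : ∀ A ∈ ⋃ α ∈ S, 𝒜 α, ∀ A' ∈ ⋃ α ∈ S, 𝒜 α, A ≠ A' →
    sSup (A ∩ A') < sSup A

/-- The set `G(S, ℬ)` of all `α ∈ S` such that `sup (A ∩ B) = α` for all `A ∈ 𝒜 α`, `B ∈ ℬ`. -/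
def guessSet (𝒜 : Ordinal.{u} → Set (Set Ordinal.{u})) (S : Set Ordinal.{u})
    (ℬ : Set (Set Ordinal.{u})) : Set Ordinal.{u} :=
  {α | α ∈ S ∧ ∀ A ∈ 𝒜 α, ∀ B ∈ ℬ, sSup (A ∩ B) = α}

/-- The principle `♣_AD(𝒮, μ, <θ)` at `κ`. -/
def ClubADLT (κ : Cardinal.{u}) (𝒮 : Set (Set Ordinal.{u})) (μ θ : Cardinal.{u + 1}) : Prop :=
  ∃ 𝒜 : Ordinal.{u} → Set (Set Ordinal.{u}),
    IsADMultiLadderSystem κ (⋃₀ 𝒮) 𝒜 ∧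
    (∀ α ∈ ⋃₀ 𝒮, #(𝒜 α) = μ) ∧
    ∀ ℬ : Set (Set Ordinal.{u}),
      (∀ B ∈ ℬ, B ⊆ Iio κ.ord ∧ #B = Cardinal.lift.{u + 1} κ) → #ℬ < θ →
      ∀ S ∈ 𝒮, IsStationaryIn κ (guessSet 𝒜 S ℬ)

/-- The principle `♣_AD(𝒮, μ, θ)` at `κ`, in which the families `ℬ` have size at most `θ`. -/
def ClubADPrinciple (κ : Cardinal.{u}) (𝒮 : Set (Set Ordinal.{u})) (μ θ : Cardinal.{u + 1}) :
    Prop :=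
  ClubADLT κ 𝒮 μ (Order.succ θ)

end ClubAD

namespace ClubAD

open Cardinal Set Filter Order

/-! Suppose 𝒜 γ = {A γ} for γ ∈ S. Weak compactness yields B ⊆ κ of size κ whose every initial
segment B ∩ β equals A γ ∩ β for some regular γ > β (`exists_coherent_ladder`). Guessing {B} on the
club of limit ordinals gives a limit α ∈ S with sup (A α ∩ B) = α. For a regular γ > α with B ∩ α =
A γ ∩ α, the set A α ∩ A γ = A α ∩ B is cofinal in α, against almost disjointness.

B consists of the δ lying in A γ for L-almost all γ, where L is a κ-complete filter concentrating on
reg κ and behaving like a normal ultrafilter for κ many prescribed functions. B is unbounded because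
γ ↦ min (A γ \ β) is regressive, hence constant modulo L. -/

theorem mk_lt_lift_of_subset_Iio {κ : Cardinal.{u}} {A : Set Ordinal.{u}} {b : Ordinal.{u}}
    (hb : b < κ.ord) (hA : A ⊆ Iio b) : #A < Cardinal.lift.{u + 1} κ := by
  refine (mk_le_mk_of_subset hA).trans_lt ?_
  rw [mk_Iio_ordinal, Cardinal.lift_lt]
  exact lt_ord.1 hb

/-- A subset of `κ` of size `κ` is unbounded in `κ`. -/
theorem exists_le_of_mk_eq {κ : Cardinal.{u}} {A : Set Ordinal.{u}}
    (hA : #A = Cardinal.lift.{u + 1} κ) {b : Ordinal.{u}} (hb : b < κ.ord) :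
    ∃ ξ ∈ A, b ≤ ξ := by
  by_contra! h
  exact (mk_lt_lift_of_subset_Iio hb h).ne hA

/-- A subset of a regular cardinal `κ` of size less than `κ` is bounded in `κ`. -/
theorem sSup_lt_ord_of_isRegular {κ : Cardinal.{u}} (hκ : κ.IsRegular) {A : Set Ordinal.{u}}
    (hA : A ⊆ Iio κ.ord) (hcard : #A < Cardinal.lift.{u + 1} κ) : sSup A < κ.ord := by
  refine Ordinal.sSup_lt_of_lt_cof ?_ hA
  rwa [← Ordinal.lift_cof, hκ.cof_ord]

/-- An unbounded subset of a regular cardinal `κ` has size `κ`. -/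
theorem mk_eq_of_unbounded {κ : Cardinal.{u}} (hκ : κ.IsRegular) {A : Set Ordinal.{u}}
    (hA : A ⊆ Iio κ.ord) (hunb : ∀ b < κ.ord, ∃ ξ ∈ A, b ≤ ξ) :
    #A = Cardinal.lift.{u + 1} κ := by
  refine le_antisymm ?_ (not_lt.1 fun hlt => ?_)
  · refine (mk_le_mk_of_subset hA).trans ?_
    rw [mk_Iio_ordinal, card_ord]
  · have hsup := sSup_lt_ord_of_isRegular hκ hA hlt
    obtain ⟨ξ, hξ, hle⟩ := hunb _ ((isSuccLimit_ord hκ.aleph0_le).succ_lt hsup)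
    exact (succ_le_iff.1 hle).not_ge (le_csSup ⟨κ.ord, fun x hx => (hA hx).le⟩ hξ)

/-- If κ were singular, it would split into cof κ many bounded blocks. Colouring pairs by "same
block", a homogeneous set lies in one block or meets each block at most once; either way it has size
less than κ. -/
theorem IsWeaklyCompact.isRegular {κ : Cardinal.{u}} (hκ : IsWeaklyCompact κ) :
    κ.IsRegular := by
  refine ⟨hκ.1.le, not_lt.1 fun hsing => ?_⟩
  obtain ⟨f, hf⟩ := Ordinal.exists_isFundamentalSeq (o := κ.ord) rfl
  have hp : ∀ α : Ordinal.{u}, ∃ i : Iio κ.ord.cof.ord, α < κ.ord → α ≤ f i := by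
    intro α
    by_cases hα : α < κ.ord
    · obtain ⟨_, ⟨i, rfl⟩, hi⟩ := hf.isCofinal_range ⟨α, hα⟩
      exact ⟨i, fun _ => hi⟩
    · refine ⟨⟨0, ?_⟩, fun h => absurd h hα⟩
      rw [mem_Iio, ord_pos, Ordinal.cof_pos, ord_pos]
      exact aleph0_pos.trans hκ.1
  choose p hp using hp
  obtain ⟨H, hH, hcard, i, hi⟩ := hκ.2 fun α β => decide (p α = p β)
  cases i with
  | true =>
    obtain ⟨ξ₀, hξ₀, -⟩ := exists_le_of_mk_eq hcard (ord_pos.2 (aleph0_pos.trans hκ.1))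
    have hconst : ∀ ξ ∈ H, p ξ = p ξ₀ := by
      intro ξ hξ
      rcases lt_trichotomy ξ ξ₀ with h | h | h
      · simpa using hi ξ hξ ξ₀ hξ₀ h
      · rw [h]
      · simpa using (of_decide_eq_true (hi ξ₀ hξ₀ ξ hξ h)).symm
    refine (mk_lt_lift_of_subset_Iio (A := H)
      ((isSuccLimit_ord hκ.1.le).succ_lt (f (p ξ₀)).2) fun ξ hξ => ?_).ne hcard
    rw [mem_Iio, lt_succ_iff, ← hconst ξ hξ]
    exact hp ξ (hH hξ)
  | false =>
    have hinj : Function.Injective fun ξ : H => p ξ := by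
      intro ξ η h
      rcases lt_trichotomy ξ.1 η.1 with hlt | heq | hlt
      · exact absurd h (of_decide_eq_false (hi _ ξ.2 _ η.2 hlt))
      · exact Subtype.ext heq
      · exact absurd h.symm (of_decide_eq_false (hi _ η.2 _ ξ.2 hlt))
    have hle := mk_le_of_injective hinj
    rw [hcard, mk_Iio_ordinal, card_ord, Cardinal.lift_le] at hle
    exact hle.not_gt hsing

/-! ### Complete filters deciding κ many sets -/

/-- The filter of subsets of `κ` containing a tail of `H`. -/
def tailFilter (κ : Cardinal.{u}) (hκ : κ.IsRegular) (H : Set Ordinal.{u}) :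
    Filter Ordinal.{u} where
  sets := {s | ∃ b < κ.ord, ∀ ξ ∈ H, b ≤ ξ → ξ ∈ s}
  univ_sets := ⟨0, hκ.ord_pos, fun _ _ _ => trivial⟩
  sets_of_superset := fun ⟨b, hb, h⟩ hst => ⟨b, hb, fun ξ hξ hle => hst (h ξ hξ hle)⟩
  inter_sets := fun ⟨b, hb, h⟩ ⟨b', hb', h'⟩ =>
    ⟨max b b', max_lt hb hb', fun ξ hξ hle =>
      ⟨h ξ hξ ((le_max_left _ _).trans hle), h' ξ hξ ((le_max_right _ _).trans hle)⟩⟩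

theorem mem_tailFilter {κ : Cardinal.{u}} {hκ : κ.IsRegular} {H s : Set Ordinal.{u}} :
    s ∈ tailFilter κ hκ H ↔ ∃ b < κ.ord, ∀ ξ ∈ H, b ≤ ξ → ξ ∈ s :=
  Iff.rfl

theorem cardinalInterFilter_tailFilter {κ : Cardinal.{u}} (hκ : κ.IsRegular)
    (H : Set Ordinal.{u}) :
    CardinalInterFilter (tailFilter κ hκ H) (Cardinal.lift.{u + 1} κ) := by
  refine ⟨fun S hS hmem => ?_⟩
  choose! b hb h using fun s hs => mem_tailFilter.1 (hmem s hs)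
  have himage : b '' S ⊆ Iio κ.ord := by
    rintro _ ⟨s, hs, rfl⟩
    exact hb s hs
  refine ⟨sSup (b '' S), sSup_lt_ord_of_isRegular hκ himage (mk_image_le.trans_lt hS),
    fun ξ hξ hle s hs => h s hs ξ hξ (hle.trans' ?_)⟩
  exact le_csSup ⟨κ.ord, fun x hx => (himage hx).le⟩ ⟨s, hs, rfl⟩

/-- `L` is a proper `κ`-complete filter on `κ` containing all tails of `κ`. -/
structure IsUniformComplete (κ : Cardinal.{u}) (L : Filter Ordinal.{u}) : Prop where
  neBot : L.NeBot
  complete : CardinalInterFilter L (Cardinal.lift.{u + 1} κ)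
  lt_ord : ∀ᶠ ξ in L, ξ < κ.ord
  le : ∀ b < κ.ord, ∀ᶠ ξ in L, b ≤ ξ

theorem IsUniformComplete.eventually_ball {κ : Cardinal.{u}} {L : Filter Ordinal.{u}}
    (hL : IsUniformComplete κ L) {γ : Ordinal.{u}} (hγ : γ < κ.ord)
    {P : Ordinal.{u} → Ordinal.{u} → Prop} (hP : ∀ ζ < γ, ∀ᶠ ξ in L, P ζ ξ) :
    ∀ᶠ ξ in L, ∀ ζ < γ, P ζ ξ := by
  have := hL.complete
  exact (eventually_cardinal_ball (mk_lt_lift_of_subset_Iio hγ subset_rfl)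
    (p := fun ξ ζ _ => P ζ ξ)).2 hP

theorem isUniformComplete_tailFilter {κ : Cardinal.{u}} (hκ : κ.IsRegular)
    {H : Set Ordinal.{u}} (hH : H ⊆ Iio κ.ord) (hcard : #H = Cardinal.lift.{u + 1} κ) :
    IsUniformComplete κ (tailFilter κ hκ H) where
  neBot := by
    refine ⟨fun hbot => ?_⟩
    obtain ⟨b, hb, h⟩ := mem_tailFilter.1 (hbot ▸ mem_bot : (∅ : Set Ordinal.{u}) ∈ _)
    obtain ⟨ξ, hξ, hle⟩ := exists_le_of_mk_eq hcard hb
    exact h ξ hξ hle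
  complete := cardinalInterFilter_tailFilter hκ H
  lt_ord := ⟨0, hκ.ord_pos, fun _ hξ _ => hH hξ⟩
  le b hb := ⟨b, hb, fun _ _ h => h⟩

/-- If `κ` is weakly compact, then any `κ` many subsets of `κ` are decided by some uniform
`κ`-complete filter. The colouring compares points lexicographically. -/
theorem IsWeaklyCompact.exists_filter_decides {κ : Cardinal.{u}} (hκ : IsWeaklyCompact κ)
    (X : Ordinal.{u} → Set Ordinal.{u}) :
    ∃ L : Filter Ordinal.{u}, IsUniformComplete κ L ∧
      ∀ η < κ.ord, X η ∈ L ∨ (X η)ᶜ ∈ L := by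
  classical
  have hreg := hκ.isRegular
  obtain ⟨H, hH, hcard, i, hi⟩ := hκ.2 fun α β =>
    decide (∃ η, (∀ ζ < η, α ∈ X ζ ↔ β ∈ X ζ) ∧ α ∉ X η ∧ β ∈ X η)
  have hL := isUniformComplete_tailFilter hreg hH hcard
  refine ⟨tailFilter κ hreg H, hL, fun η => ?_⟩
  induction η using WellFoundedLT.induction with
  | ind η ih =>
    intro hη
    -- By induction and completeness, points of H past a single b agree on all X ζ with ζ < η.
    -- Lexicographic monotonicity then makes membership in X η monotone along that tail, hence
    -- eventually constant.
    have hagree : ∃ b < κ.ord, ∀ ξ ∈ H, b ≤ ξ → ∀ ξ' ∈ H, b ≤ ξ' →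
        ∀ ζ < η, ξ ∈ X ζ ↔ ξ' ∈ X ζ := by
      have hev := hL.eventually_ball hη
        (P := fun ζ ξ => ξ ∈ X ζ ↔ X ζ ∈ tailFilter κ hreg H) (fun ζ hζ => by
          rcases ih ζ hζ (hζ.trans hη) with h | h
          · filter_upwards [h] with ξ hξ
            exact iff_of_true hξ h
          · have := hL.neBot
            have hn : X ζ ∉ tailFilter κ hreg H := fun h' => by
              simpa using inter_mem h h'
            filter_upwards [h] with ξ hξ
            exact iff_of_false hξ hn)
      obtain ⟨b, hb, h⟩ := mem_tailFilter.1 hev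
      exact ⟨b, hb, fun ξ hξ hle ξ' hξ' hle' ζ hζ =>
        (h ξ hξ hle ζ hζ).trans (h ξ' hξ' hle' ζ hζ).symm⟩
    obtain ⟨b, hb, hagree⟩ := hagree
    cases i with
    | true =>
      have hmono : ∀ ξ ∈ H, b ≤ ξ → ∀ ξ' ∈ H, ξ < ξ' → ξ ∈ X η → ξ' ∈ X η := by
        intro ξ hξ hle ξ' hξ' hlt hmem
        obtain ⟨θ, hθ, hn, hy⟩ := of_decide_eq_true (hi ξ hξ ξ' hξ' hlt)
        have hag := hagree ξ hξ hle ξ' hξ' (hle.trans hlt.le)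
        rcases lt_trichotomy θ η with h | h | h
        · exact absurd ((hag θ h).2 hy) hn
        · exact absurd (h ▸ hmem) hn
        · exact (hθ η h).1 hmem
      by_cases hex : ∃ ξ ∈ H, b ≤ ξ ∧ ξ ∈ X η
      · obtain ⟨ξ, hξ, hle, hmem⟩ := hex
        refine Or.inl ⟨ξ, hH hξ, fun ξ' hξ' hle' => ?_⟩
        rcases hle'.eq_or_lt with rfl | hlt
        · exact hmem
        · exact hmono ξ hξ hle ξ' hξ' hlt hmem
      · push Not at hex
        exact Or.inr ⟨b, hb, hex⟩
    | false =>
      have hmono : ∀ ξ ∈ H, b ≤ ξ → ∀ ξ' ∈ H, ξ < ξ' → ξ ∉ X η → ξ' ∉ X η := by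
        intro ξ hξ hle ξ' hξ' hlt hn hmem
        exact of_decide_eq_false (hi ξ hξ ξ' hξ' hlt)
          ⟨η, hagree ξ hξ hle ξ' hξ' (hle.trans hlt.le), hn, hmem⟩
      by_cases hex : ∃ ξ ∈ H, b ≤ ξ ∧ ξ ∉ X η
      · obtain ⟨ξ, hξ, hle, hmem⟩ := hex
        refine Or.inr ⟨ξ, hH hξ, fun ξ' hξ' hle' => ?_⟩
        rcases hle'.eq_or_lt with rfl | hlt
        · exact hmem
        · exact hmono ξ hξ hle ξ' hξ' hlt hmem
      · push Not at hex
        exact Or.inl ⟨b, hb, hex⟩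

theorem IsWeaklyCompact.exists_filter_decides_family {κ : Cardinal.{u}}
    (hκ : IsWeaklyCompact κ) {ι : Type (u + 1)} (hι : #ι ≤ Cardinal.lift.{u + 1} κ)
    (X : ι → Set Ordinal.{u}) :
    ∃ L : Filter Ordinal.{u}, IsUniformComplete κ L ∧ ∀ i, X i ∈ L ∨ (X i)ᶜ ∈ L := by
  have hemb : #ι ≤ #(Iio κ.ord) := by rwa [mk_Iio_ordinal, card_ord]
  obtain ⟨e⟩ := hemb
  obtain ⟨L, hL, h⟩ := hκ.exists_filter_decides fun η => {ξ | ∃ i, (e i).1 = η ∧ ξ ∈ X i}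
  refine ⟨L, hL, fun i => ?_⟩
  have heq : {ξ | ∃ j, (e j).1 = (e i).1 ∧ ξ ∈ X j} = X i := by
    ext ξ
    constructor
    · rintro ⟨j, hj, hξ⟩
      rwa [← e.injective (Subtype.ext hj)]
    · exact fun hξ => ⟨i, rfl, hξ⟩
  simpa only [heq] using h (e i) (e i).2

/-- If f avoided each ζ < γ almost everywhere, completeness would make it avoid all of them at once.
-/
theorem IsUniformComplete.exists_eventually_eq {κ : Cardinal.{u}} {L : Filter Ordinal.{u}}
    (hL : IsUniformComplete κ L) {f : Ordinal.{u} → Ordinal.{u}} {γ : Ordinal.{u}}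
    (hγ : γ < κ.ord) (hlt : ∀ᶠ ξ in L, f ξ < γ)
    (hdec : ∀ ζ < γ, (∀ᶠ ξ in L, f ξ = ζ) ∨ ∀ᶠ ξ in L, f ξ ≠ ζ) :
    ∃ δ < κ.ord, ∀ᶠ ξ in L, f ξ = δ := by
  have := hL.neBot
  by_contra! h
  have hne : ∀ ζ < γ, ∀ᶠ ξ in L, f ξ ≠ ζ := fun ζ hζ =>
    (hdec ζ hζ).resolve_left fun h' => h ζ (hζ.trans hγ) (h'.mono fun _ => not_not.2)
  obtain ⟨ξ, h₁, h₂⟩ := ((hL.eventually_ball hγ hne).and hlt).exists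
  exact h₁ _ h₂ rfl

/-- Strict inequality modulo a `κ`-complete filter, `κ` uncountable, is well-founded. -/
theorem IsUniformComplete.wellFounded_eventually_lt {κ : Cardinal.{u}} {L : Filter Ordinal.{u}}
    (hκ : ℵ₀ < κ) (hL : IsUniformComplete κ L) {ι : Type*} (f : ι → Ordinal.{u} → Ordinal.{u}) :
    WellFounded fun i j => ∀ᶠ ξ in L, f i ξ < f j ξ := by
  have := hL.neBot
  have := hL.complete
  have : CountableInterFilter L :=
    CardinalInterFilter.toCountableInterFilter (c := Cardinal.lift.{u + 1} κ) L (by simpa)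
  rw [wellFounded_iff_isEmpty_descending_chain]
  refine ⟨fun ⟨s, hs⟩ => ?_⟩
  -- All inequalities of the chain hold at a common ξ, giving a descending sequence of ordinals.
  obtain ⟨ξ, hξ⟩ := (eventually_countable_forall.2 hs).exists
  exact (wellFounded_iff_isEmpty_descending_chain.1
    (wellFounded_lt (α := Ordinal.{u}))).false ⟨fun n => f (s n) ξ, hξ⟩

/-! ### Normality for κ many functions -/

/-- If `κ` is weakly compact, then for any `κ` many functions there is a uniform `κ`-complete
filter modulo which each of them is constant or at least the identity. The filter is the image of
a deciding one under a least function not bounded below `κ`. -/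
theorem IsWeaklyCompact.exists_normal_filter {κ : Cardinal.{u}} (hκ : IsWeaklyCompact κ)
    {ι : Type (u + 1)} (hι : #ι ≤ Cardinal.lift.{u + 1} κ) (g : ι → Ordinal.{u} → Ordinal.{u}) :
    ∃ L : Filter Ordinal.{u}, IsUniformComplete κ L ∧
      ∀ i, (∀ᶠ γ in L, γ ≤ g i γ) ∨ ∃ δ < κ.ord, ∀ᶠ γ in L, g i γ = δ := by
  have hinf : ℵ₀ ≤ Cardinal.lift.{u + 1} κ := by simpa using hκ.1.le
  let op : ι ⊕ Iio κ.ord → Ordinal.{u} → Ordinal.{u} := Sum.elim g fun δ _ => δ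
  -- Words in the g i and the constants: closed under composing with g i on the left, with the empty
  -- word as identity.
  let fn : List (ι ⊕ Iio κ.ord) → Ordinal.{u} → Ordinal.{u} := fun w ξ => w.foldr op ξ
  have hcard : #(List (ι ⊕ Iio κ.ord)) ≤ Cardinal.lift.{u + 1} κ := by
    refine (mk_list_le_max _).trans (max_le hinf ?_)
    rw [mk_sum, Cardinal.lift_id, Cardinal.lift_id, mk_Iio_ordinal, card_ord]
    exact add_le_of_le hinf hι le_rfl
  obtain ⟨L, hL, hdec⟩ := hκ.exists_filter_decides_family
    (ι := List (ι ⊕ Iio κ.ord) × List (ι ⊕ Iio κ.ord))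
    (by
      rw [mk_prod, Cardinal.lift_id]
      exact mul_le_of_le hinf hcard hcard)
    fun p => {ξ | fn p.1 ξ ≤ fn p.2 ξ}
  have hle : ∀ v w, (∀ᶠ ξ in L, fn v ξ ≤ fn w ξ) ∨ ∀ᶠ ξ in L, fn w ξ < fn v ξ := by
    intro v w
    refine (hdec (v, w)).imp id fun h => ?_
    filter_upwards [h] with ξ hξ
    exact not_le.1 hξ
  have hleC : ∀ w, ∀ δ < κ.ord, (∀ᶠ ξ in L, fn w ξ ≤ δ) ∨ ∀ᶠ ξ in L, δ < fn w ξ :=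
    fun w δ hδ => hle w [Sum.inr ⟨δ, hδ⟩]
  have hCle : ∀ w, ∀ δ < κ.ord, (∀ᶠ ξ in L, δ ≤ fn w ξ) ∨ ∀ᶠ ξ in L, fn w ξ < δ :=
    fun w δ hδ => hle [Sum.inr ⟨δ, hδ⟩] w
  have hwf := hL.wellFounded_eventually_lt hκ.1 fn
  obtain ⟨w, hw, hmin⟩ := hwf.has_min {w | ∀ b < κ.ord, ∀ᶠ ξ in L, b ≤ fn w ξ} ⟨[], hL.le⟩
  have := hL.neBot
  have := hL.complete
  have hid : ∀ᶠ ξ in L, fn w ξ ≤ ξ := (hle w []).resolve_right (hmin [] hL.le)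
  refine ⟨L.map (fn w), ⟨inferInstance, inferInstance, ?_, fun b hb => hw b hb⟩, fun i => ?_⟩
  · rw [eventually_map]
    filter_upwards [hid, hL.lt_ord] with ξ h₁ h₂
    exact h₁.trans_lt h₂
  · simp only [eventually_map]
    -- If g i ∘ fn w drops below fn w, minimality of w bounds it below κ, and completeness makes it
    -- constant.
    refine (hle w (Sum.inl i :: w)).imp id fun hlt => ?_
    have hbdd : ¬ ∀ b < κ.ord, ∀ᶠ ξ in L, b ≤ fn (Sum.inl i :: w) ξ := fun h => hmin _ h hlt
    simp only [not_forall] at hbdd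
    obtain ⟨b, hb, hbn⟩ := hbdd
    refine hL.exists_eventually_eq hb ((hCle (Sum.inl i :: w) b hb).resolve_left hbn)
      fun ζ hζ => ?_
    rcases hleC (Sum.inl i :: w) ζ (hζ.trans hb) with h₁ | h₁
    · rcases hCle (Sum.inl i :: w) ζ (hζ.trans hb) with h₂ | h₂
      · left
        filter_upwards [h₁, h₂] with ξ h₁ h₂
        exact le_antisymm h₁ h₂
      · right
        filter_upwards [h₂] with ξ h₂
        exact h₂.ne
    · right
      filter_upwards [h₁] with ξ h₁
      exact h₁.ne'

/-- The filter of `IsWeaklyCompact.exists_normal_filter` may be taken to contain `reg κ`. -/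
theorem IsWeaklyCompact.exists_normal_filter_reg {κ : Cardinal.{u}} (hκ : IsWeaklyCompact κ)
    {ι : Type (u + 1)} (hι : #ι ≤ Cardinal.lift.{u + 1} κ) (g : ι → Ordinal.{u} → Ordinal.{u}) :
    ∃ L : Filter Ordinal.{u}, IsUniformComplete κ L ∧ (∀ᶠ γ in L, γ ∈ reg κ) ∧
      ∀ i, (∀ᶠ γ in L, γ ≤ g i γ) ∨ ∃ δ < κ.ord, ∀ᶠ γ in L, g i γ = δ := by
  classical
  have hinf : ℵ₀ ≤ Cardinal.lift.{u + 1} κ := by simpa using hκ.1.le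
  choose e he using fun γ : Ordinal.{u} => Ordinal.exists_isFundamentalSeq (o := γ) rfl
  let c : Ordinal.{u} → Ordinal.{u} → Ordinal.{u} :=
    fun i γ => if h : i < γ.cof.ord then e γ ⟨i, h⟩ else 0
  obtain ⟨L, hL, hg⟩ := hκ.exists_normal_filter (ι := ι ⊕ Option (Iio κ.ord))
    (by
      rw [mk_sum, Cardinal.lift_id, Cardinal.lift_id, mk_option, mk_Iio_ordinal, card_ord]
      exact add_le_of_le hinf hι (add_le_of_le hinf le_rfl (one_le_aleph0.trans hinf)))
    (Sum.elim g fun o => o.elim (fun γ => γ.cof.ord) fun i => c i)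
  have := hL.neBot
  refine ⟨L, hL, ?_, fun i => hg (Sum.inl i)⟩
  rcases hg (Sum.inr none) with h | ⟨μ, hμ, h⟩
  · have hω : Ordinal.omega0 < κ.ord := by
      rw [← ord_aleph0]
      exact ord_lt_ord.2 hκ.1
    filter_upwards [h, hL.le _ hω, hL.lt_ord] with γ hγ hωγ hγκ
    have heq : γ.cof.ord = γ := le_antisymm (Ordinal.ord_cof_le γ) hγ
    refine ⟨γ.cof, ⟨?_, ?_⟩, ?_, heq.symm⟩
    · rw [← ord_le_ord, heq, ord_aleph0]
      exact hωγ
    · rw [heq]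
    · rw [← ord_lt_ord, heq]
      exact hγκ
  -- With constant cofinality μ < κ, each entry c i of the fundamental sequences, being below γ, is
  -- constant modulo L. The supremum of these μ constants is below κ, so they cannot be cofinal in
  -- large γ.
  · exfalso
    have hcof : ∀ᶠ γ in L, γ.cof.ord = μ := h
    have hconst : ∀ i < μ, ∃ δ < κ.ord, ∀ᶠ γ in L, c i γ = δ := by
      intro i hi
      refine (hg (Sum.inr (some ⟨i, hi.trans hμ⟩))).resolve_left fun hle => ?_
      obtain ⟨γ, hγ, hγμ⟩ := (hle.and hcof).exists
      have hγ' : γ ≤ c i γ := hγ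
      have hi' : i < γ.cof.ord := hγμ ▸ hi
      simp only [c, dif_pos hi'] at hγ'
      exact (e γ ⟨i, hi'⟩).2.not_ge hγ'
    choose! d hd hcd using hconst
    have hsub : d '' Iio μ ⊆ Iio κ.ord := by
      rintro _ ⟨i, hi, rfl⟩
      exact hd i hi
    have hsup : sSup (d '' Iio μ) < κ.ord := sSup_lt_ord_of_isRegular hκ.isRegular hsub
      (mk_image_le.trans_lt (mk_lt_lift_of_subset_Iio hμ subset_rfl))
    have hlim := isSuccLimit_ord hκ.1.le
    obtain ⟨γ, hγ, hγμ, hγc⟩ := ((hL.le _ (hlim.succ_lt (hlim.succ_lt hsup))).and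
      (hcof.and (hL.eventually_ball hμ hcd))).exists
    obtain ⟨_, ⟨⟨i, hi⟩, rfl⟩, hle⟩ :=
      (he γ).isCofinal_range ⟨succ (sSup (d '' Iio μ)), succ_le_iff.1 hγ⟩
    have hiμ : i < μ := hγμ ▸ hi
    have hci := hγc i hiμ
    simp only [c, dif_pos (mem_Iio.1 hi)] at hci
    have hle' : succ (sSup (d '' Iio μ)) ≤ d i := hci ▸ hle
    exact (succ_le_iff.1 hle').not_ge (le_csSup ⟨κ.ord, fun x hx => (hsub hx).le⟩ ⟨i, hiμ, rfl⟩)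

/-! ### The coherent set B -/

/-- If `κ` is weakly compact and `A γ` is cofinal in `γ` for every regular `γ < κ`, then some
`B ⊆ κ` of size `κ` is such that each of its initial segments is one of some `A γ`. -/
theorem IsWeaklyCompact.exists_coherent_ladder {κ : Cardinal.{u}} (hκ : IsWeaklyCompact κ)
    (A : Ordinal.{u} → Set Ordinal.{u}) (hA : ∀ γ ∈ reg κ, IsCofinalIn (A γ) γ) :
    ∃ B ⊆ Iio κ.ord, #B = Cardinal.lift.{u + 1} κ ∧
      ∀ β < κ.ord, ∃ γ ∈ reg κ, β < γ ∧ B ∩ Iio β = A γ ∩ Iio β := by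
  classical
  have hinf : ℵ₀ ≤ Cardinal.lift.{u + 1} κ := by simpa using hκ.1.le
  have hlim := isSuccLimit_ord hκ.1.le
  let next : Iio κ.ord → Ordinal.{u} → Ordinal.{u} := fun β γ => sInf (A γ ∩ Ici β.1)
  let ind : Iio κ.ord → Ordinal.{u} → Ordinal.{u} := fun δ γ => if δ.1 ∈ A γ then 1 else 0
  obtain ⟨L, hL, hreg, hg⟩ := hκ.exists_normal_filter_reg (ι := Iio κ.ord ⊕ Iio κ.ord)
    (by
      rw [mk_sum, Cardinal.lift_id, mk_Iio_ordinal, card_ord]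
      exact add_le_of_le hinf le_rfl le_rfl)
    (Sum.elim next ind)
  have := hL.neBot
  have hgt : ∀ b < κ.ord, ∀ᶠ γ in L, b < γ := fun b hb =>
    (hL.le _ (hlim.succ_lt hb)).mono fun _ => succ_le_iff.1
  have hnext : ∀ β : Iio κ.ord, ∀ᶠ γ in L,
      next β γ ∈ A γ ∧ β.1 ≤ next β γ ∧ next β γ < γ := by
    intro β
    filter_upwards [hreg, hgt β β.2] with γ hγ hβγ
    obtain ⟨δ, hδ, hβδ⟩ := (hA γ hγ).2 β hβγ
    have hmem : next β γ ∈ A γ ∩ Ici β.1 := csInf_mem ⟨δ, hδ, hβδ⟩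
    exact ⟨hmem.1, hmem.2, (hA γ hγ).1 hmem.1⟩
  have hdec : ∀ δ < κ.ord, ∀ᶠ γ in L, (∀ᶠ γ' in L, δ ∈ A γ') ↔ δ ∈ A γ := by
    intro δ hδ
    rcases hg (Sum.inr ⟨δ, hδ⟩) with h | ⟨ε, -, h⟩
    -- An indicator is at most 1, so it cannot dominate the identity.
    · obtain ⟨γ, hγ, hγ'⟩ := (h.and (hgt 1 (by
        rw [← ord_one, ord_lt_ord]
        exact one_lt_aleph0.trans hκ.1))).exists
      have hle : ind ⟨δ, hδ⟩ γ ≤ 1 := by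
        simp only [ind]
        split_ifs <;> simp
      exact absurd (LE.le.trans hγ hle) hγ'.not_ge
    · have h' : ∀ᶠ γ in L, (δ ∈ A γ ↔ ε = 1) := by
        filter_upwards [h] with γ hγ
        simp only [Sum.elim_inr, ind] at hγ
        rw [← hγ]
        split_ifs with hmem <;> simp [hmem]
      filter_upwards [h'] with γ hγ
      rw [hγ]
      constructor
      · intro hev
        obtain ⟨γ', h₁, h₂⟩ := (hev.and h').exists
        exact h₂.1 h₁
      · exact fun hε => h'.mono fun _ h => h.2 hε
  refine ⟨{δ | δ < κ.ord ∧ ∀ᶠ γ in L, δ ∈ A γ}, fun δ hδ => hδ.1, ?_, fun β hβ => ?_⟩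
  · refine mk_eq_of_unbounded hκ.isRegular (fun δ hδ => hδ.1) fun b hb => ?_
    rcases hg (Sum.inl ⟨b, hb⟩) with h | ⟨δ, hδ, h⟩
    · obtain ⟨γ, h₁, h₂⟩ := (h.and (hnext ⟨b, hb⟩)).exists
      exact absurd h₁ h₂.2.2.not_ge
    · have hδ' : ∀ᶠ γ in L, δ ∈ A γ ∧ b ≤ δ := by
        filter_upwards [h, hnext ⟨b, hb⟩] with γ h₁ h₂
        simp only [Sum.elim_inl] at h₁
        rw [← h₁]
        exact ⟨h₂.1, h₂.2.1⟩
      obtain ⟨γ, -, hle⟩ := hδ'.exists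
      exact ⟨δ, ⟨hδ, hδ'.mono fun _ h => h.1⟩, hle⟩
  · obtain ⟨γ, hγ, hβγ, hall⟩ := (hreg.and ((hgt β hβ).and
      (hL.eventually_ball hβ fun δ hδ => hdec δ (hδ.trans hβ)))).exists
    refine ⟨γ, hγ, hβγ, ?_⟩
    ext δ
    simp only [mem_inter_iff, mem_ofPred_eq, mem_Iio]
    constructor
    · rintro ⟨⟨-, h⟩, hδ⟩
      exact ⟨(hall δ hδ).1 h, hδ⟩
    · rintro ⟨h, hδ⟩
      exact ⟨⟨hδ.trans hβ, (hall δ hδ).2 h⟩, hδ⟩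

/-! ### Limit ordinals and the contradiction -/

theorem mem_acc_Iio_of_isSuccLimit {o γ : Ordinal.{u}} (hγ : IsSuccLimit γ) (hlt : γ < o) :
    γ ∈ acc (Iio o) := by
  refine ⟨hlt, ?_, hγ.bot_lt⟩
  rw [inter_eq_right.2 (Iio_subset_Iio hlt.le)]
  exact hγ.isLUB_Iio.csSup_eq ⟨0, hγ.bot_lt⟩

theorem isSuccLimit_of_mem_reg {κ : Cardinal.{u}} {γ : Ordinal.{u}} (hγ : γ ∈ reg κ) :
    IsSuccLimit γ := by
  obtain ⟨μ, hμ, -, rfl⟩ := hγ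
  exact isSuccLimit_ord hμ.aleph0_le

theorem IsCofinalIn.sSup_eq {A : Set Ordinal.{u}} {γ : Ordinal.{u}} (hA : IsCofinalIn A γ)
    (hγ : IsSuccLimit γ) : sSup A = γ := by
  refine le_antisymm (csSup_le' fun δ hδ => (hA.1 hδ).le) (le_of_forall_lt fun β hβ => ?_)
  obtain ⟨δ, hδ, hle⟩ := hA.2 _ (hγ.succ_lt hβ)
  exact (succ_le_iff.1 hle).trans_le (le_csSup ⟨γ, fun x hx => (hA.1 hx).le⟩ hδ)

/-- The limit ordinals below an uncountable cardinal form a club. -/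
theorem isClub_isSuccLimit {κ : Cardinal.{u}} (hκ : ℵ₀ < κ) :
    IsClub {x : Iio κ.ord | IsSuccLimit x.1} := by
  refine ⟨fun d hd hne _ x hx => ?_, fun x => ?_⟩
  · obtain ⟨y₀, hy₀⟩ := hne
    refine ⟨not_isMin_iff.2 ⟨0, (hd hy₀).bot_lt.trans_le (hx.1 hy₀)⟩, fun a ha => ?_⟩
    obtain ⟨y, hy, hay⟩ := (lt_isLUB_iff hx (b := ⟨a, ha.lt.trans x.2⟩)).1 ha.lt
    rcases (hx.1 hy).eq_or_lt with rfl | hlt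
    · exact (hd hy).isSuccPrelimit a ha
    · exact ha.2 hay hlt
  · have hω : Ordinal.omega0 < κ.ord := by
      rw [← ord_aleph0]
      exact ord_lt_ord.2 hκ
    refine ⟨⟨x.1 + Ordinal.omega0, Ordinal.isPrincipal_add_ord hκ.le x.2 hω⟩, ?_, ?_⟩
    · exact Ordinal.isSuccLimit_add _ Ordinal.isSuccLimit_omega0
    · exact Subtype.coe_le_coe.1 (le_self_add)

end ClubAD

theorem mainTheorem7 (κ : Cardinal.{u}) (hκ : ClubAD.IsWeaklyCompact κ)
    (S : Set Ordinal.{u}) (hreg : ClubAD.reg κ ⊆ S) (hS : S ⊆ Set.Iio κ.ord) :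
    ¬ ClubAD.ClubADPrinciple κ {S} 1 1 := by
  rintro ⟨𝒜, h𝒜, hone, hguess⟩
  rw [Set.sUnion_singleton] at h𝒜 hone
  have hsingle : ∀ γ, ∃ A : Set Ordinal.{u}, γ ∈ S → 𝒜 γ = {A} := by
    intro γ
    by_cases hγ : γ ∈ S
    · obtain ⟨A, hA⟩ := Cardinal.mk_set_eq_one_iff.1 (hone γ hγ)
      exact ⟨A, fun _ => hA⟩
    · exact ⟨∅, fun h => absurd h hγ⟩
  choose A hA using hsingle
  have hcof : ∀ γ ∈ S, Order.IsSuccLimit γ → ClubAD.IsCofinalIn (A γ) γ := fun γ hγ hlim =>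
    h𝒜.cofinal γ ⟨hγ, ClubAD.mem_acc_Iio_of_isSuccLimit hlim (hS hγ)⟩ _ (by simp [hA γ hγ])
  obtain ⟨B, hB, hcard, hcoh⟩ := hκ.exists_coherent_ladder A fun γ hγ =>
    hcof γ (hreg hγ) (ClubAD.isSuccLimit_of_mem_reg hγ)
  obtain ⟨⟨α, hακ⟩, ⟨hαS, hα⟩, hlim⟩ :=
    hguess {B} (by simpa using ⟨hB, hcard⟩)
      (by rw [Cardinal.mk_singleton]; exact Order.lt_succ 1) S rfl
      (ClubAD.isClub_isSuccLimit hκ.1)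
  obtain ⟨γ, hγ, hαγ, heq⟩ := hcoh α hακ
  have hsup := hα (A α) (by simp [hA α hαS]) B rfl
  have hcofα := hcof α hαS hlim
  have hcofγ := hcof γ (hreg hγ) (ClubAD.isSuccLimit_of_mem_reg hγ)
  have hsupα := hcofα.sSup_eq hlim
  -- The suprema α < γ tell the two ladders apart.
  have hne : A α ≠ A γ := fun h => by
    have := hcofγ.sSup_eq (ClubAD.isSuccLimit_of_mem_reg hγ)
    rw [← h, hsupα] at this
    exact hαγ.ne this
  have hlt := h𝒜.almost_disjoint (A α) (Set.mem_biUnion hαS (by simp [hA α hαS]))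
    (A γ) (Set.mem_biUnion (hreg hγ) (by simp [hA γ (hreg hγ)])) hne
  have hinter : A α ∩ B = A α ∩ A γ := by
    rw [← Set.inter_eq_left.2 hcofα.1, Set.inter_assoc, Set.inter_assoc,
      Set.inter_comm _ B, Set.inter_comm _ (A γ), heq]
  rw [← hinter, hsupα] at hlt
  exact hlt.ne hsup
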